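/- A \emph{cartesian bicategory} is a poset-enriched symmetric monoidal category $(\mathcal C,\otimes,I)$ in which every object $X$ carries a commutative comonoid $\Delta_X\colon X\to X\otimes X$, $!_X\colon X\to I$ and a commutative monoid $\mu_X\colon X\otimes X\to X$, $\eta_X\colon I\to X$, both coherent with $\otimes$ and $I$, such that (composition being written in diagrammatic order): (i) every arrow $c\colon X\to Y$ is a lax comonoid homomorphism, $c;\Delta_Y\le \Delta_X;(c\otimes c)$ and $c;!_Y\le\, !_X$; (ii) $\Delta_X$ is left adjoint to $\mu_X$ and $!_X$ is left adjoint to $\eta_X$; (iii) $\Delta_X;\mu_X=\mathrm{id}_X$ and $(\Delta_X\otimes \mathrm{id}_X);(\mathrm{id}_X\otimes\mu_X)=(\mathrm{id}_X\otimes\Delta_X);(\mu_X\otimes \mathrm{id}_X)$. An arrow $c$ is a \emph{map} if both inequalities in (i) are equalities; $\mathsf{Map}(\mathcal C)$ is the category of objects and maps of $\mathcal C$, which has finite products given by $\otimes$ and $I$. The homsets of $\mathcal C$ are inf-semilattices with $c\wedge d=\Delta_X;(c\otimes d);\mu_Y$ and $\top=\,!_X;\eta_Y$. The \emph{dagger}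 of $c\colon X\to Y$ is the arrow $c^\dagger\colon Y\to X$ obtained by bending its two wires: $c^\dagger=((\eta_X;\Delta_X)\otimes \mathrm{id}_Y);(\mathrm{id}_X\otimes c\otimes \mathrm{id}_Y);(\mathrm{id}_X\otimes(\mu_Y;!_Y))$, up to the structural isomorphisms. $\mathcal C$ is \emph{functionally complete} if every arrow $r\colon X\to I$ has a \emph{tabulation}, that is, a map $i\colon X_r\to X$ with $i;i^\dagger=\mathrm{id}_{X_r}$ and $i^\dagger;!_{X_r}=r$. An \emph{elementary and existential doctrine} is a functor $P\colon\mathcal D^{\mathrm{op}}\to\mathsf{InfSl}$ from a category $\mathcal D$ with finite products to inf-semilattices (with top) such that (a) for every $Y$ there is $\delta_Y\in P(Y\times Y)$ such that, for every $X$, $\alpha\mapsto P_{\langle\pi_1,\pi_2\rangle}(\alpha)\wedge P_{\langle\pi_2,\pi_3\rangle}(\delta_Y)$ is left adjoint to $P_{\mathrm{id}_X\times\langle \mathrm{id}_Y,\mathrm{id}_Y\rangle}\colon P(X\times Y\times Y)\to P(X\times Y)$; (b) for every projection $\pi_X\colon X\times Y\to X$, $P_{\pi_X}$ has a left adjoint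 $\exists_{\pi_X}$, and these satisfy the Beck--Chevalley condition and Frobenius reciprocity. A \emph{comprehension} of $\alpha\in P(X)$ is an arrow $c\colon X_\alpha\to X$ of $\mathcal D$ such that $P_c(\alpha)=\top$ and every $f\colon Y\to X$ with $P_f(\alpha)=\top$ factors as $f=g;c$ for a unique $g\colon Y\to X_\alpha$. The doctrine $P$ has \emph{full comprehensions} if every $\alpha\in P(X)$ has a comprehension and, for all $X$ and all $\alpha,\beta\in P(X)$, $\alpha\le\beta$ whenever a comprehension of $\alpha$ factors through a comprehension of $\beta$. For a cartesian bicategory $\mathcal C$, the functor $\mathcal C[-,I]\colon\mathsf{Map}(\mathcal C)^{\mathrm{op}}\to\mathsf{InfSl}$, acting on maps by precomposition, is an elementary and existential doctrine. \textbf{Theorem.} A cartesian bicategory $\mathcal C$ is functionally complete if and only if the elementary and existential doctrine $\mathcal C[-,I]\colon\mathsf{Map}(\mathcal C)^{\mathrm{op}}\to\mathsf{InfSl}$ has full comprehensions. -/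

import Mathlib

open CategoryTheory MonoidalCategory
open scoped ComonObj MonObj

universe w v u

/-- A cartesian bicategory (of relations): a poset-enriched symmetric monoidal category in which
every object carries a commutative comonoid `(Δ, ε)` and a commutative monoid `(μ, η)`, both
coherent with `⊗` and `𝟙_`, such that every arrow is a lax comonoid homomorphism, the comonoids are
left adjoint to the monoids, and monoids and comonoids form special Frobenius bimonoids.
The symmetric monoidal structure and the coherent comonoids are those of
`CopyDiscardCategory`. -/
class CartesianBicategory (C : Type u) [Category.{v} C] [MonoidalCategory C]
    extends CopyDiscardCategory C where
  [homOrder : ∀ X Y : C, PartialOrder (X ⟶ Y)]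
  comp_le_comp : ∀ {X Y Z : C} {f f' : X ⟶ Y} {g g' : Y ⟶ Z},
    f ≤ f' → g ≤ g' → f ≫ g ≤ f' ≫ g'
  tensor_le_tensor : ∀ {X Y X' Y' : C} {f f' : X ⟶ Y} {g g' : X' ⟶ Y'},
    f ≤ f' → g ≤ g' → (f ⊗ₘ g) ≤ (f' ⊗ₘ g')
  [monObj : ∀ X : C, MonObj X]
  [isCommMonObj : ∀ X : C, IsCommMonObj X]
  cocopy_tensor : ∀ X Y : C, μ[X ⊗ Y] = tensorμ X Y X Y ≫ (μ[X] ⊗ₘ μ[Y])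
  codiscard_tensor : ∀ X Y : C, η[X ⊗ Y] = (λ_ (𝟙_ C)).inv ≫ (η[X] ⊗ₘ η[Y])
  cocopy_unit : (monObj (𝟙_ C)).mul = (λ_ (𝟙_ C)).hom
  codiscard_unit : (monObj (𝟙_ C)).one = 𝟙 (𝟙_ C)
  copy_lax : ∀ {X Y : C} (c : X ⟶ Y), c ≫ Δ[Y] ≤ Δ[X] ≫ (c ⊗ₘ c)
  discard_lax : ∀ {X Y : C} (c : X ⟶ Y), c ≫ ε[Y] ≤ ε[X]
  id_le_copy_cocopy : ∀ X : C, 𝟙 X ≤ Δ[X] ≫ μ[X]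
  cocopy_copy_le_id : ∀ X : C, μ[X] ≫ Δ[X] ≤ 𝟙 (X ⊗ X)
  id_le_discard_codiscard : ∀ X : C, 𝟙 X ≤ ε[X] ≫ η[X]
  codiscard_discard_le_id : ∀ X : C, η[X] ≫ ε[X] ≤ 𝟙 (𝟙_ C)
  special : ∀ X : C, Δ[X] ≫ μ[X] = 𝟙 X
  frobenius : ∀ X : C, (Δ[X] ▷ X) ≫ (α_ X X X).hom ≫ (X ◁ μ[X]) =
    (X ◁ Δ[X]) ≫ (α_ X X X).inv ≫ (μ[X] ▷ X)

namespace CartesianBicategory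

attribute [reducible] homOrder monObj
attribute [instance] homOrder isCommMonObj
-- The given (co)monoids take precedence over the ones that could be synthesized on `X ⊗ Y`, `𝟙_`.
attribute [instance 2000] monObj CopyDiscardCategory.comonObj

variable {C : Type u} [Category.{v} C] [MonoidalCategory C] [CartesianBicategory C]

/-- The inf-semilattice structure on homsets: `c ∧ d = Δ ≫ (c ⊗ d) ≫ μ`. -/
instance homSemilatticeInf (X Y : C) : SemilatticeInf (X ⟶ Y) where
  toPartialOrder := homOrder X Y
  inf c d := Δ[X] ≫ (c ⊗ₘ d) ≫ μ[Y]
  inf_le_left c d := by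
    have hd : d ≤ ε[X] ≫ η[Y] := by
      calc d = d ≫ 𝟙 Y := by simp
        _ ≤ d ≫ ε[Y] ≫ η[Y] := comp_le_comp le_rfl (id_le_discard_codiscard Y)
        _ = (d ≫ ε[Y]) ≫ η[Y] := by simp
        _ ≤ _ := comp_le_comp (discard_lax d) le_rfl
    calc Δ[X] ≫ (c ⊗ₘ d) ≫ μ[Y] ≤ Δ[X] ≫ (c ⊗ₘ (ε[X] ≫ η[Y])) ≫ μ[Y] :=
          comp_le_comp le_rfl (comp_le_comp (tensor_le_tensor le_rfl hd) le_rfl)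
      _ = (Δ[X] ≫ (c ⊗ₘ ε[X])) ≫ (Y ◁ η[Y]) ≫ μ[Y] := by
          rw [← id_tensorHom, Category.assoc, tensorHom_comp_tensorHom_assoc, Category.comp_id]
      _ = c := by simp
  inf_le_right c d := by
    have hd : c ≤ ε[X] ≫ η[Y] := by
      calc c = c ≫ 𝟙 Y := by simp
        _ ≤ c ≫ ε[Y] ≫ η[Y] := comp_le_comp le_rfl (id_le_discard_codiscard Y)
        _ = (c ≫ ε[Y]) ≫ η[Y] := by simp
        _ ≤ _ := comp_le_comp (discard_lax c) le_rfl
    calc Δ[X] ≫ (c ⊗ₘ d) ≫ μ[Y] ≤ Δ[X] ≫ ((ε[X] ≫ η[Y]) ⊗ₘ d) ≫ μ[Y] :=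
          comp_le_comp le_rfl (comp_le_comp (tensor_le_tensor hd le_rfl) le_rfl)
      _ = (Δ[X] ≫ (ε[X] ⊗ₘ d)) ≫ (η[Y] ▷ Y) ≫ μ[Y] := by
          rw [← tensorHom_id, Category.assoc, tensorHom_comp_tensorHom_assoc, Category.comp_id]
      _ = d := by simp
  le_inf a c d h h' := by
    calc a = a ≫ Δ[Y] ≫ μ[Y] := by rw [special, Category.comp_id]
      _ = (a ≫ Δ[Y]) ≫ μ[Y] := by simp
      _ ≤ (Δ[X] ≫ (a ⊗ₘ a)) ≫ μ[Y] := comp_le_comp (copy_lax a) le_rfl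
      _ = Δ[X] ≫ (a ⊗ₘ a) ≫ μ[Y] := by simp
      _ ≤ _ := comp_le_comp le_rfl (comp_le_comp (tensor_le_tensor h h') le_rfl)

/-- The top element of a homset: `⊤ = ε ≫ η`. -/
instance homOrderTop (X Y : C) : OrderTop (X ⟶ Y) where
  top := ε[X] ≫ η[Y]
  le_top d := by
    calc d = d ≫ 𝟙 Y := by simp
      _ ≤ d ≫ ε[Y] ≫ η[Y] := comp_le_comp le_rfl (id_le_discard_codiscard Y)
      _ = (d ≫ ε[Y]) ≫ η[Y] := by simp
      _ ≤ _ := comp_le_comp (discard_lax d) le_rfl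

theorem inf_def {X Y : C} (c d : X ⟶ Y) : c ⊓ d = Δ[X] ≫ (c ⊗ₘ d) ≫ μ[Y] := rfl

theorem top_def (X Y : C) : (⊤ : X ⟶ Y) = ε[X] ≫ η[Y] := rfl

/-- The dagger `c† : Y ⟶ X` of `c : X ⟶ Y`, obtained by bending the two wires of `c`. -/
def dagger {X Y : C} (c : X ⟶ Y) : Y ⟶ X :=
  (λ_ Y).inv ≫ ((η[X] ≫ Δ[X]) ▷ Y) ≫ (α_ X X Y).hom ≫ (X ◁ (c ▷ Y)) ≫
    (X ◁ (μ[Y] ≫ ε[Y])) ≫ (ρ_ X).hom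

variable (C) in
/-- The maps of a cartesian bicategory: the arrows for which the two lax comonoid homomorphism
inequalities hold in the opposite direction as well. -/
def isMap : MorphismProperty C := fun X Y c =>
  Δ[X] ≫ (c ⊗ₘ c) ≤ c ≫ Δ[Y] ∧ ε[X] ≤ c ≫ ε[Y]

theorem isMap.copy {X Y : C} {c : X ⟶ Y} (h : isMap C c) : c ≫ Δ[Y] = Δ[X] ≫ (c ⊗ₘ c) :=
  le_antisymm (copy_lax c) h.1

theorem isMap.discard {X Y : C} {c : X ⟶ Y} (h : isMap C c) : c ≫ ε[Y] = ε[X] :=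
  le_antisymm (discard_lax c) h.2

/-- An arrow with a right adjoint is a map. -/
theorem isMap_of_adjoint {X Y : C} (f : X ⟶ Y) (g : Y ⟶ X) (h : 𝟙 X ≤ f ≫ g)
    (h' : g ≫ f ≤ 𝟙 Y) : isMap C f := by
  constructor
  · calc Δ[X] ≫ (f ⊗ₘ f) = 𝟙 X ≫ Δ[X] ≫ (f ⊗ₘ f) := by simp
      _ ≤ (f ≫ g) ≫ Δ[X] ≫ (f ⊗ₘ f) := comp_le_comp h le_rfl
      _ = f ≫ (g ≫ Δ[X]) ≫ (f ⊗ₘ f) := by simp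
      _ ≤ f ≫ (Δ[Y] ≫ (g ⊗ₘ g)) ≫ (f ⊗ₘ f) :=
          comp_le_comp le_rfl (comp_le_comp (copy_lax g) le_rfl)
      _ = f ≫ Δ[Y] ≫ ((g ≫ f) ⊗ₘ (g ≫ f)) := by simp
      _ ≤ f ≫ Δ[Y] ≫ (𝟙 Y ⊗ₘ 𝟙 Y) :=
          comp_le_comp le_rfl (comp_le_comp le_rfl (tensor_le_tensor h' h'))
      _ = f ≫ Δ[Y] := by simp
  · calc ε[X] = 𝟙 X ≫ ε[X] := by simp
      _ ≤ (f ≫ g) ≫ ε[X] := comp_le_comp h le_rfl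
      _ = f ≫ g ≫ ε[X] := by simp
      _ ≤ f ≫ ε[Y] := comp_le_comp le_rfl (discard_lax g)

theorem isMap_iso_hom {X Y : C} (e : X ≅ Y) : isMap C e.hom :=
  isMap_of_adjoint e.hom e.inv (by simp) (by simp)

theorem isMap_iso_inv {X Y : C} (e : X ≅ Y) : isMap C e.inv :=
  isMap_iso_hom e.symm

instance : (isMap C).IsMultiplicative where
  id_mem X := isMap_iso_hom (Iso.refl X)
  comp_mem f g hf hg := by
    constructor
    · rw [Category.assoc, hg.copy, ← Category.assoc, hf.copy]; simp
    · rw [Category.assoc, hg.discard, hf.discard]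

instance : (isMap C).IsMonoidal := by
  apply MorphismProperty.IsMonoidal.mk'
  intro X₁ X₂ Y₁ Y₂ f g hf hg
  constructor
  · rw [CopyDiscardCategory.copy_tensor, CopyDiscardCategory.copy_tensor, Category.assoc,
      ← tensorμ_natural, tensorHom_comp_tensorHom_assoc, tensorHom_comp_tensorHom_assoc,
      hf.copy, hg.copy]
  · rw [CopyDiscardCategory.discard_tensor, CopyDiscardCategory.discard_tensor,
      tensorHom_comp_tensorHom_assoc, hf.discard, hg.discard]

instance : (isMap C).IsMonoidalStable where
  associator_hom_mem _ _ _ := isMap_iso_hom _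
  associator_inv_mem _ _ _ := isMap_iso_inv _
  leftUnitor_hom_mem _ := isMap_iso_hom _
  leftUnitor_inv_mem _ := isMap_iso_inv _
  rightUnitor_hom_mem _ := isMap_iso_hom _
  rightUnitor_inv_mem _ := isMap_iso_inv _

theorem isMap_copy (X : C) : isMap C Δ[X] :=
  isMap_of_adjoint _ _ (id_le_copy_cocopy X) (cocopy_copy_le_id X)

theorem isMap_discard (X : C) : isMap C ε[X] :=
  isMap_of_adjoint _ _ (id_le_discard_codiscard X) (codiscard_discard_le_id X)

variable (C) in
/-- `Map(C)`: the objects of `C` and the maps between them. -/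
abbrev MapCat := WideSubcategory (isMap C)

theorem copy_proj (X Y : C) :
    Δ[X ⊗ Y] ≫ ((X ◁ ε[Y] ≫ (ρ_ X).hom) ⊗ₘ (ε[X] ▷ Y ≫ (λ_ Y).hom)) = 𝟙 (X ⊗ Y) := by
  have h := tensorμ_natural (𝟙 X) ε[X] ε[Y] (𝟙 Y)
  have hβ : (β_ (𝟙_ C) (𝟙_ C)).hom = 𝟙 _ := by
    have := braiding_leftUnitor (𝟙_ C)
    rw [← cancel_mono (λ_ (𝟙_ C)).hom, this, Category.id_comp, unitors_equal]
  have h₂ : ((ρ_ X).inv ⊗ₘ (λ_ Y).inv) ≫ tensorμ X (𝟙_ C) (𝟙_ C) Y ≫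
      ((ρ_ X).hom ⊗ₘ (λ_ Y).hom) = 𝟙 (X ⊗ Y) := by
    simp only [tensorμ, hβ]
    monoidal
  calc
    _ = (Δ[X] ⊗ₘ Δ[Y]) ≫ (tensorμ X X Y Y ≫ ((𝟙 X ⊗ₘ ε[Y]) ⊗ₘ (ε[X] ⊗ₘ 𝟙 Y))) ≫
        ((ρ_ X).hom ⊗ₘ (λ_ Y).hom) := by
      rw [CopyDiscardCategory.copy_tensor]
      simp only [Category.assoc, tensorHom_comp_tensorHom, id_tensorHom, tensorHom_id]
    _ = ((Δ[X] ≫ (𝟙 X ⊗ₘ ε[X])) ⊗ₘ (Δ[Y] ≫ (ε[Y] ⊗ₘ 𝟙 Y))) ≫ tensorμ X (𝟙_ C) (𝟙_ C) Y ≫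
        ((ρ_ X).hom ⊗ₘ (λ_ Y).hom) := by
      rw [← tensorμ_natural, ← tensorHom_comp_tensorHom]
      simp only [Category.assoc]
    _ = 𝟙 (X ⊗ Y) := by
      rw [← h₂]
      simp only [id_tensorHom, tensorHom_id, ComonObj.comul_counit, ComonObj.counit_comul]

theorem copy_fst {X Y Z : C} (f : Z ⟶ X) {g : Z ⟶ Y} (hg : isMap C g) :
    (Δ[Z] ≫ (f ⊗ₘ g)) ≫ X ◁ ε[Y] ≫ (ρ_ X).hom = f := by
  rw [Category.assoc, ← id_tensorHom, tensorHom_comp_tensorHom_assoc, hg.discard]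
  simp

theorem copy_snd {X Y Z : C} {f : Z ⟶ X} (hf : isMap C f) (g : Z ⟶ Y) :
    (Δ[Z] ≫ (f ⊗ₘ g)) ≫ ε[X] ▷ Y ≫ (λ_ Y).hom = g := by
  rw [Category.assoc, ← tensorHom_id, tensorHom_comp_tensorHom_assoc, hf.discard]
  simp

/-- `Map(C)` has finite products: the product of `X` and `Y` is `X ⊗ Y` and the terminal object
is the monoidal unit. -/
instance : CartesianMonoidalCategory (MapCat C) where
  isTerminalTensorUnit := Limits.IsTerminal.ofUniqueHom (fun X => ⟨ε[X.obj], isMap_discard _⟩)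
    (fun X m => by
      ext
      have := m.2.discard
      rw [CopyDiscardCategory.discard_unit] at this
      simpa using this)
  fst X Y := ⟨X.obj ◁ ε[Y.obj] ≫ (ρ_ X.obj).hom,
    (isMap C).comp_mem _ _ ((isMap C).whiskerLeft_mem _ _ (isMap_discard _)) (isMap_iso_hom _)⟩
  snd X Y := ⟨ε[X.obj] ▷ Y.obj ≫ (λ_ Y.obj).hom,
    (isMap C).comp_mem _ _ ((isMap C).whiskerRight_mem _ (isMap_discard _) _) (isMap_iso_hom _)⟩
  fst_def X Y := rfl
  snd_def X Y := rfl
  tensorProductIsBinaryProduct X Y := Limits.BinaryFan.isLimitMk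
    (fun s => ⟨Δ[s.pt.obj] ≫ (s.fst.hom ⊗ₘ s.snd.hom),
      (isMap C).comp_mem _ _ (isMap_copy _) ((isMap C).tensorHom_mem _ _ s.fst.2 s.snd.2)⟩)
    (fun s => WideSubcategory.hom_ext _ (copy_fst _ s.snd.2))
    (fun s => WideSubcategory.hom_ext _ (copy_snd s.fst.2 _))
    (fun s m h h' => by
      ext
      have h₁ : s.fst.hom = m.hom ≫ X.obj ◁ ε[Y.obj] ≫ (ρ_ X.obj).hom := by rw [← h]; rfl
      have h₂ : s.snd.hom = m.hom ≫ ε[X.obj] ▷ Y.obj ≫ (λ_ Y.obj).hom := by rw [← h']; rfl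
      dsimp only
      rw [h₁, h₂, ← tensorHom_comp_tensorHom]
      have := m.2.copy
      erw [← reassoc_of% this]
      erw [copy_proj]
      simp)

theorem frobenius_right (X : C) :
    (X ◁ Δ[X]) ≫ (α_ X X X).inv ≫ (μ[X] ▷ X) = μ[X] ≫ Δ[X] := by
  have hu : Δ[X] = (ρ_ X).inv ≫ X ◁ (η[X] ≫ Δ[X]) ≫ (α_ X X X).inv ≫ (μ[X] ▷ X) := by
    rw [MonoidalCategory.whiskerLeft_comp, Category.assoc, ← frobenius,
      whisker_exchange_assoc]
    simp [← MonoidalCategory.whiskerLeft_comp]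
  have key : X ◁ (η[X] ≫ Δ[X]) ≫ (α_ X X X).inv ≫ (μ[X] ▷ X) = (ρ_ X).hom ≫ Δ[X] := by
    conv_rhs => rw [hu]
    simp
  calc (X ◁ Δ[X]) ≫ (α_ X X X).inv ≫ (μ[X] ▷ X)
      = X ◁ ((ρ_ X).inv ≫ X ◁ (η[X] ≫ Δ[X]) ≫ (α_ X X X).inv ≫ (μ[X] ▷ X)) ≫
          (α_ X X X).inv ≫ (μ[X] ▷ X) := by rw [← hu]
    _ = (ρ_ (X ⊗ X)).inv ≫ (X ⊗ X) ◁ (η[X] ≫ Δ[X]) ≫ (α_ (X ⊗ X) X X).inv ≫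
          ((α_ X X X).hom ≫ X ◁ μ[X] ≫ μ[X]) ▷ X := by
        simp
    _ = (ρ_ (X ⊗ X)).inv ≫ (X ⊗ X) ◁ (η[X] ≫ Δ[X]) ≫ (μ[X] ▷ (X ⊗ X)) ≫
          (α_ X X X).inv ≫ (μ[X] ▷ X) := by
        rw [← MonObj.mul_assoc]
        simp only [comp_whiskerRight, associator_inv_naturality_left_assoc]
    _ = (ρ_ (X ⊗ X)).inv ≫ (μ[X] ▷ _) ≫ (X ◁ (η[X] ≫ Δ[X])) ≫ (α_ X X X).inv ≫ (μ[X] ▷ X) := by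
        rw [whisker_exchange_assoc]
    _ = μ[X] ≫ Δ[X] := by
        rw [key]
        simp

theorem frobenius_left (X : C) :
    (Δ[X] ▷ X) ≫ (α_ X X X).hom ≫ (X ◁ μ[X]) = μ[X] ≫ Δ[X] := by
  rw [frobenius, frobenius_right]

end CartesianBicategory

/-! ### Elementary and existential doctrines -/

section Doctrines

open CartesianMonoidalCategory Opposite

variable {D : Type u} [Category.{v} D]

theorem lift_fst_id [CartesianMonoidalCategory D] (X Y : D) :
    lift (fst X Y) (𝟙 (X ⊗ Y)) = lift (𝟙 X) (𝟙 X) ▷ Y ≫ (α_ X X Y).hom := by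
  ext <;> simp

theorem lift_whiskerLeft_fst_snd [CartesianMonoidalCategory D] (X Y : D) :
    lift (X ◁ fst Y Y) (snd X (Y ⊗ Y)) =
      X ◁ (lift (𝟙 Y) (𝟙 Y) ▷ Y ≫ (α_ Y Y Y).hom) ≫ (α_ X Y (Y ⊗ Y)).inv := by
  ext <;> simp

/-- The action `P_f : P(Y) → P(X)` of a functor `P : Dᵒᵖ ⥤ InfSl` on an arrow `f : X ⟶ Y`. -/
abbrev reindex (P : Dᵒᵖ ⥤ SemilatInfCat.{w}) {X Y : D} (f : X ⟶ Y) :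
    InfTopHom (P.obj (op Y)) (P.obj (op X)) :=
  P.map f.op

/-- The conditions on a functor `P : Dᵒᵖ ⥤ InfSl`, where `D` has finite products, to be an
elementary and existential doctrine. -/
structure IsElementaryExistential [CartesianMonoidalCategory D] (P : Dᵒᵖ ⥤ SemilatInfCat.{w}) :
    Prop where
  /-- Every `Y` has an equality predicate `δ` such that `P_{⟨π₁,π₂⟩}(α) ∧ P_{⟨π₂,π₃⟩}(δ)` is the
  value at `α` of a left adjoint to reindexing along `id × Δ : X × Y ⟶ X × (Y × Y)`. -/
  elementary : ∀ Y : D, ∃ δ : P.obj (op (Y ⊗ Y)), ∀ X : D,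
    GaloisConnection
      (fun α : P.obj (op (X ⊗ Y)) =>
        reindex P (X ◁ fst Y Y) α ⊓ reindex P (snd X (Y ⊗ Y)) δ)
      (reindex P (X ◁ lift (𝟙 Y) (𝟙 Y)))
  /-- Reindexing along projections has left adjoints, which satisfy the Beck-Chevalley condition
  and Frobenius reciprocity. -/
  existential : ∃ E : ∀ X Y : D, P.obj (op (X ⊗ Y)) → P.obj (op X),
    (∀ X Y, GaloisConnection (E X Y) (reindex P (fst X Y))) ∧
    (∀ (X X' Y : D) (f : X' ⟶ X) (α : P.obj (op (X ⊗ Y))),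
      reindex P f (E X Y α) = E X' Y (reindex P (f ▷ Y) α)) ∧
    (∀ (X Y : D) (α : P.obj (op (X ⊗ Y))) (β : P.obj (op X)),
      E X Y (reindex P (fst X Y) β ⊓ α) = β ⊓ E X Y α)

variable (D) in
/-- An elementary and existential doctrine on a category `D` with finite products. -/
structure ElementaryExistentialDoctrine [CartesianMonoidalCategory D] where
  /-- The underlying functor to inf-semilattices. -/
  functor : Dᵒᵖ ⥤ SemilatInfCat.{w}
  isElementaryExistential : IsElementaryExistential functor

namespace ElementaryExistentialDoctrine

variable [CartesianMonoidalCategory D] (P : ElementaryExistentialDoctrine.{w} D)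

/-- The arrow `c : Z ⟶ X` is a comprehension of the element `α` of `P(X)`. -/
def IsComprehension {X : D} (α : P.functor.obj (op X)) {Z : D} (c : Z ⟶ X) : Prop :=
  reindex P.functor c α = ⊤ ∧
    ∀ (Y : D) (f : Y ⟶ X), reindex P.functor f α = ⊤ → ∃! g : Y ⟶ Z, f = g ≫ c

/-- Every element has a comprehension. -/
def HasComprehensions : Prop :=
  ∀ (X : D) (α : P.functor.obj (op X)), ∃ (Z : D) (c : Z ⟶ X), P.IsComprehension α c

/-- `P` has comprehensions, and `α ≤ β` whenever a comprehension of `α` factors through a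
comprehension of `β`. -/
def HasFullComprehensions : Prop :=
  P.HasComprehensions ∧
    ∀ (X : D) (α β : P.functor.obj (op X)) (Z W : D) (c : Z ⟶ X) (d : W ⟶ X),
      P.IsComprehension α c → P.IsComprehension β d → (∃ g : Z ⟶ W, c = g ≫ d) → α ≤ β

end ElementaryExistentialDoctrine

end Doctrines

namespace CartesianBicategory

open CartesianMonoidalCategory Opposite

variable (C : Type u) [Category.{v} C] [MonoidalCategory C] [CartesianBicategory C]

/-- The functor `C[-, I] : Map(C)ᵒᵖ ⥤ InfSl`, acting on maps by precomposition. -/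
def homFunctor : (MapCat C)ᵒᵖ ⥤ SemilatInfCat.{v} where
  obj X := SemilatInfCat.of (X.unop.obj ⟶ 𝟙_ C)
  map {X Y} f :=
    { toFun := fun r => f.unop.hom ≫ r
      map_inf' := fun r s => by
        have := f.unop.2.copy
        simp only [inf_def]
        rw [reassoc_of% this, tensorHom_comp_tensorHom_assoc]
      map_top' := by
        have := f.unop.2.discard
        simp only [top_def]
        rw [reassoc_of% this] }
  map_id X := by
    apply InfTopHom.ext
    intro r
    exact Category.id_comp _
  map_comp f g := by
    apply InfTopHom.ext
    intro r
    exact Category.assoc _ _ _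

variable {C} in
theorem reindex_homFunctor {X Y : MapCat C} (f : X ⟶ Y) (r : Y.obj ⟶ 𝟙_ C) :
    reindex (homFunctor C) f r = f.hom ≫ r := rfl

variable {C} in
theorem whiskerLeft_mono (X : C) {Y Z : C} {f g : Y ⟶ Z} (h : f ≤ g) : X ◁ f ≤ X ◁ g := by
  rw [← id_tensorHom, ← id_tensorHom]
  exact tensor_le_tensor le_rfl h

variable {C} in
theorem inf_unit {X : C} (r s : X ⟶ 𝟙_ C) : r ⊓ s = Δ[X] ≫ (r ⊗ₘ s) ≫ (ρ_ (𝟙_ C)).hom := by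
  rw [inf_def, cocopy_unit, unitors_equal]

variable {C} in
theorem lift_hom {X Y Z : MapCat C} (f : Z ⟶ X) (g : Z ⟶ Y) :
    (lift f g).hom = Δ[Z.obj] ≫ (f.hom ⊗ₘ g.hom) := rfl

variable {C} in
theorem elementary_eq {X Y : MapCat C} (r : X.obj ⊗ Y.obj ⟶ 𝟙_ C) :
    ((X ◁ fst Y Y).hom ≫ r) ⊓ ((snd X (Y ⊗ Y)).hom ≫ μ[Y.obj] ≫ ε[Y.obj]) =
      (X.obj ◁ μ[Y.obj]) ≫ r := by
  have h' := congrArg (fun f => f.hom) (lift_whiskerLeft_fst_snd X Y)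
  rw [lift_hom] at h'
  have hΔ : (lift (𝟙 Y) (𝟙 Y)).hom = Δ[Y.obj] := by rw [lift_hom]; simp
  rw [inf_unit, ← tensorHom_comp_tensorHom, Category.assoc]
  rw [reassoc_of% h']
  have hr : (r ⊗ₘ (μ[Y.obj] ≫ ε[Y.obj])) ≫ (ρ_ (𝟙_ C)).hom =
      (X.obj ⊗ Y.obj) ◁ (μ[Y.obj] ≫ ε[Y.obj]) ≫ (ρ_ (X.obj ⊗ Y.obj)).hom ≫ r := by
    rw [MonoidalCategory.tensorHom_def', Category.assoc, rightUnitor_naturality]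
  have hμ : (Δ[Y.obj] ▷ Y.obj ≫ (α_ _ _ _).hom ≫ Y.obj ◁ μ[Y.obj]) ≫ Y.obj ◁ ε[Y.obj] ≫
      (ρ_ Y.obj).hom = μ[Y.obj] := by
    rw [frobenius_left]; simp
  rw [hr]
  conv_rhs => rw [← hμ]
  simp [hΔ]

/-- The functor `C[-, I]` is an elementary and existential doctrine: equality is `μ ≫ ε`, and
quantification over `Y` is precomposition with `η`. -/
theorem isElementaryExistential_homFunctor : IsElementaryExistential (homFunctor C) where
  elementary Y := by
    refine ⟨μ[Y.obj] ≫ ε[Y.obj], fun X r s => ?_⟩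
    change X.obj ⊗ Y.obj ⟶ 𝟙_ C at r
    change X.obj ⊗ (Y.obj ⊗ Y.obj) ⟶ 𝟙_ C at s
    have hΔ : (X ◁ lift (𝟙 Y) (𝟙 Y)).hom = X.obj ◁ Δ[Y.obj] := by
      simp [lift_hom]
    change ((X ◁ fst Y Y).hom ≫ r) ⊓ ((snd X (Y ⊗ Y)).hom ≫ μ[Y.obj] ≫ ε[Y.obj]) ≤ s ↔
      r ≤ (X ◁ lift (𝟙 Y) (𝟙 Y)).hom ≫ s
    rw [elementary_eq, hΔ]
    constructor
    · intro h
      calc r = X.obj ◁ (Δ[Y.obj] ≫ μ[Y.obj]) ≫ r := by simp [special]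
        _ = X.obj ◁ Δ[Y.obj] ≫ X.obj ◁ μ[Y.obj] ≫ r := by simp
        _ ≤ _ := comp_le_comp le_rfl h
    · intro h
      calc X.obj ◁ μ[Y.obj] ≫ r ≤ X.obj ◁ μ[Y.obj] ≫ X.obj ◁ Δ[Y.obj] ≫ s :=
            comp_le_comp le_rfl h
        _ = X.obj ◁ (μ[Y.obj] ≫ Δ[Y.obj]) ≫ s := by simp
        _ ≤ X.obj ◁ (𝟙 _) ≫ s :=
            comp_le_comp (whiskerLeft_mono _ (cocopy_copy_le_id _)) le_rfl
        _ = s := by simp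
  existential := by
    refine ⟨fun X Y r => (ρ_ X.obj).inv ≫ X.obj ◁ η[Y.obj] ≫ r, fun X Y r s => ?_,
      fun X X' Y f r => ?_, fun X Y r s => ?_⟩
    · change X.obj ⊗ Y.obj ⟶ 𝟙_ C at r
      change X.obj ⟶ 𝟙_ C at s
      change (ρ_ X.obj).inv ≫ X.obj ◁ η[Y.obj] ≫ r ≤ s ↔
        r ≤ (X.obj ◁ ε[Y.obj] ≫ (ρ_ X.obj).hom) ≫ s
      constructor
      · intro h
        calc r = X.obj ◁ 𝟙 _ ≫ r := by simp
          _ ≤ X.obj ◁ (ε[Y.obj] ≫ η[Y.obj]) ≫ r :=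
            comp_le_comp (whiskerLeft_mono _ (id_le_discard_codiscard _)) le_rfl
          _ = (X.obj ◁ ε[Y.obj] ≫ (ρ_ X.obj).hom) ≫ (ρ_ X.obj).inv ≫ X.obj ◁ η[Y.obj] ≫ r := by
            simp
          _ ≤ _ := comp_le_comp le_rfl h
      · intro h
        calc (ρ_ X.obj).inv ≫ X.obj ◁ η[Y.obj] ≫ r
            ≤ (ρ_ X.obj).inv ≫ X.obj ◁ η[Y.obj] ≫ (X.obj ◁ ε[Y.obj] ≫ (ρ_ X.obj).hom) ≫ s :=
              comp_le_comp le_rfl (comp_le_comp le_rfl h)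
          _ = (ρ_ X.obj).inv ≫ X.obj ◁ (η[Y.obj] ≫ ε[Y.obj]) ≫ (ρ_ X.obj).hom ≫ s := by simp
          _ ≤ (ρ_ X.obj).inv ≫ X.obj ◁ (𝟙 _) ≫ (ρ_ X.obj).hom ≫ s :=
              comp_le_comp le_rfl
                (comp_le_comp (whiskerLeft_mono _ (codiscard_discard_le_id _)) le_rfl)
          _ = s := by simp
    · change X.obj ⊗ Y.obj ⟶ 𝟙_ C at r
      change f.hom ≫ (ρ_ X.obj).inv ≫ X.obj ◁ η[Y.obj] ≫ r =
        (ρ_ X'.obj).inv ≫ X'.obj ◁ η[Y.obj] ≫ (f.hom ▷ Y.obj) ≫ r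
      rw [whisker_exchange_assoc]
      simp
    · change X.obj ⊗ Y.obj ⟶ 𝟙_ C at r
      change X.obj ⟶ 𝟙_ C at s
      change (ρ_ X.obj).inv ≫ X.obj ◁ η[Y.obj] ≫
          (((X.obj ◁ ε[Y.obj] ≫ (ρ_ X.obj).hom) ≫ s) ⊓ r) =
        s ⊓ ((ρ_ X.obj).inv ≫ X.obj ◁ η[Y.obj] ≫ r)
      have h' := congrArg (fun f => f.hom) (lift_fst_id X Y)
      rw [lift_hom] at h'
      have hΔ : (lift (𝟙 X) (𝟙 X)).hom = Δ[X.obj] := by rw [lift_hom]; simp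
      have hf : (fst X Y).hom = (X.obj ◁ ε[Y.obj] ≫ (ρ_ X.obj).hom) := rfl
      rw [← hf, inf_unit, inf_unit, ← Category.id_comp r, ← tensorHom_comp_tensorHom,
        Category.assoc]
      erw [reassoc_of% h']
      have hs : (s ⊗ₘ ((ρ_ X.obj).inv ≫ X.obj ◁ η[Y.obj] ≫ r)) =
          X.obj ◁ ((ρ_ X.obj).inv ≫ X.obj ◁ η[Y.obj]) ≫ (s ⊗ₘ r) := by
        rw [← id_tensorHom X.obj ((ρ_ X.obj).inv ≫ X.obj ◁ η[Y.obj]), tensorHom_comp_tensorHom]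
        simp
      simp only [Category.id_comp]
      rw [hs]
      have hc : (lift (𝟙 X) (𝟙 X) ▷ Y ≫ (α_ X X Y).hom).hom =
          Δ[X.obj] ▷ Y.obj ≫ (α_ X.obj X.obj Y.obj).hom := by
        rw [← hΔ]; rfl
      rw [hc, Category.assoc, whisker_exchange_assoc]
      simp

/-- The elementary and existential doctrine `C[-, I] : Map(C)ᵒᵖ ⥤ InfSl` of `C`. -/
def homDoctrine : ElementaryExistentialDoctrine.{v} (MapCat C) where
  functor := homFunctor C
  isElementaryExistential := isElementaryExistential_homFunctor C

variable {C} in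
/-- The map `i : Z ⟶ X` is a tabulation of `r : X ⟶ I`. -/
def IsTabulation {X Z : C} (r : X ⟶ 𝟙_ C) (i : Z ⟶ X) : Prop :=
  isMap C i ∧ i ≫ dagger i = 𝟙 Z ∧ dagger i ≫ ε[Z] = r

/-- Every arrow `r : X ⟶ I` has a tabulation. -/
def FunctionallyComplete : Prop :=
  ∀ (X : C) (r : X ⟶ 𝟙_ C), ∃ (Z : C) (i : Z ⟶ X), IsTabulation r i

end CartesianBicategory

/-! Read an arrow `X ⟶ I` as a predicate on `X` and an arrow `X ⟶ Y` as a relation. Bending wires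
shows that a map `f` is left adjoint to `dagger f`: totality gives the unit, single-valuedness the
counit. So `dagger f ≫ ε` is the image of `f`, and it lies below `s` exactly when `s` is true along
`f` (`isMap.dagger_comp_le_iff`).

If `i` tabulates `r` and `r` is true along a map `f`, then `f` factors as `(f ≫ dagger i) ≫ i`,
uniquely because `i` is split by `dagger i` (`IsTabulation.isComprehension`). Fullness follows since
`r` is the image of `i`.

Conversely, fullness lets `r ≤ s` be tested along a comprehension of `r` (`le_of_isComprehension`).
For a comprehension `i` of `r`, this is used twice: the kernel predicate of `i` implies equality,
giving `i ≫ dagger i = 𝟙`, and `r` implies the image of `i`, giving `dagger i ≫ ε = r`. -/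

namespace CartesianBicategory

open CartesianMonoidalCategory Opposite

variable {C : Type u} [Category.{v} C] [MonoidalCategory C] [CartesianBicategory C]

/-! ### Bending wires -/

/-- The arrow `Y ⟶ X` obtained from `r : X ⊗ Y ⟶ I` by bending the wire `X`. -/
def bend {X Y : C} (r : X ⊗ Y ⟶ 𝟙_ C) : Y ⟶ X :=
  (λ_ Y).inv ≫ ((η[X] ≫ Δ[X]) ▷ Y) ≫ (α_ X X Y).hom ≫ (X ◁ r) ≫ (ρ_ X).hom

theorem bend_mono {X Y : C} {r s : X ⊗ Y ⟶ 𝟙_ C} (h : r ≤ s) : bend r ≤ bend s :=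
  comp_le_comp le_rfl (comp_le_comp le_rfl (comp_le_comp le_rfl
    (comp_le_comp (whiskerLeft_mono _ h) le_rfl)))

/-- The snake equation: Frobenius turns the zigzag into `μ ≫ Δ`, and the unit and counit laws cancel
the rest. -/
theorem bend_cocopy_discard (X : C) : bend (μ[X] ≫ ε[X]) = 𝟙 X := by
  have h := frobenius_left X
  calc bend (μ[X] ≫ ε[X])
      = (λ_ X).inv ≫ (η[X] ▷ X) ≫ ((Δ[X] ▷ X) ≫ (α_ X X X).hom ≫ (X ◁ μ[X])) ≫
          X ◁ ε[X] ≫ (ρ_ X).hom := by simp [bend]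
    _ = 𝟙 X := by rw [h]; simp

/-- Reduces an inequality between `h ≫ dagger c` and an identity to one between predicates, since
`bend` is monotone and sends `μ ≫ ε` to the identity. -/
theorem comp_dagger {X Y Z : C} (h : Z ⟶ Y) (c : X ⟶ Y) :
    h ≫ dagger c = bend ((c ⊗ₘ h) ≫ μ[Y] ≫ ε[Y]) := by
  simp only [dagger, bend, MonoidalCategory.tensorHom_def', comp_whiskerRight, Category.assoc,
    MonoidalCategory.whiskerLeft_comp]
  rw [leftUnitor_inv_naturality_assoc, whisker_exchange_assoc, whisker_exchange_assoc,
    associator_naturality_right_assoc]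

/-- Slides `h` along the free leg of the cup `η ≫ Δ`, so that `c` and `h` act on the two copies and
laxness of copying becomes applicable. -/
theorem dagger_comp {X Y Z : C} (c : X ⟶ Y) (h : X ⟶ Z) :
    dagger c ≫ h = (λ_ Y).inv ≫ ((η[X] ≫ Δ[X] ≫ (h ⊗ₘ c)) ▷ Y) ≫ (α_ Z Y Y).hom ≫
      (Z ◁ (μ[Y] ≫ ε[Y])) ≫ (ρ_ Z).hom := by
  simp only [dagger, MonoidalCategory.tensorHom_def', comp_whiskerRight, Category.assoc,
    MonoidalCategory.whiskerLeft_comp, associator_naturality_left_assoc,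
    associator_naturality_middle_assoc, whisker_exchange_assoc]
  rw [← rightUnitor_naturality, whisker_exchange_assoc, whisker_exchange_assoc,
    whisker_exchange_assoc]

/-! ### Maps are left adjoint to their daggers -/

theorem whiskerRight_mono {X Y : C} {f g : X ⟶ Y} (h : f ≤ g) (Z : C) : f ▷ Z ≤ g ▷ Z := by
  rw [← tensorHom_id, ← tensorHom_id]
  exact tensor_le_tensor h le_rfl

theorem cocopy_lax {X Y : C} (c : X ⟶ Y) : μ[X] ≫ c ≤ (c ⊗ₘ c) ≫ μ[Y] :=
  calc μ[X] ≫ c = μ[X] ≫ (c ≫ Δ[Y]) ≫ μ[Y] := by simp [special]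
    _ ≤ μ[X] ≫ (Δ[X] ≫ (c ⊗ₘ c)) ≫ μ[Y] :=
        comp_le_comp le_rfl (comp_le_comp (copy_lax c) le_rfl)
    _ = (μ[X] ≫ Δ[X]) ≫ (c ⊗ₘ c) ≫ μ[Y] := by simp
    _ ≤ 𝟙 _ ≫ (c ⊗ₘ c) ≫ μ[Y] := comp_le_comp (cocopy_copy_le_id X) le_rfl
    _ = (c ⊗ₘ c) ≫ μ[Y] := Category.id_comp _

theorem codiscard_lax {X Y : C} (c : X ⟶ Y) : η[X] ≫ c ≤ η[Y] :=
  calc η[X] ≫ c ≤ ⊤ := le_top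
    _ = η[Y] := by rw [top_def, CopyDiscardCategory.discard_unit, Category.id_comp]

theorem top_unit (X : C) : (⊤ : X ⟶ 𝟙_ C) = ε[X] := by
  rw [top_def, codiscard_unit, Category.comp_id]

/-- Totality alone suffices here; `isMap.eq_of_le` needs this for an arrow not yet known to be a
map. -/
theorem id_le_comp_dagger {X Y : C} (c : X ⟶ Y) (h : ε[X] ≤ c ≫ ε[Y]) : 𝟙 X ≤ c ≫ dagger c := by
  rw [comp_dagger, ← bend_cocopy_discard]
  apply bend_mono
  calc μ[X] ≫ ε[X] ≤ μ[X] ≫ c ≫ ε[Y] := comp_le_comp le_rfl h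
    _ = (μ[X] ≫ c) ≫ ε[Y] := by simp
    _ ≤ ((c ⊗ₘ c) ≫ μ[Y]) ≫ ε[Y] := comp_le_comp (cocopy_lax c) le_rfl
    _ = _ := Category.assoc _ _ _

theorem dagger_comp_le_id {X Y : C} (c : X ⟶ Y) (h : Δ[X] ≫ (c ⊗ₘ c) ≤ c ≫ Δ[Y]) :
    dagger c ≫ c ≤ 𝟙 Y := by
  rw [dagger_comp, ← bend_cocopy_discard]
  refine comp_le_comp le_rfl (comp_le_comp (whiskerRight_mono ?_ _) le_rfl)
  calc η[X] ≫ Δ[X] ≫ (c ⊗ₘ c) ≤ η[X] ≫ c ≫ Δ[Y] := comp_le_comp le_rfl h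
    _ = (η[X] ≫ c) ≫ Δ[Y] := by simp
    _ ≤ η[Y] ≫ Δ[Y] := comp_le_comp (codiscard_lax c) le_rfl

theorem dagger_mono {X Y : C} {c d : X ⟶ Y} (h : c ≤ d) : dagger c ≤ dagger d :=
  comp_le_comp le_rfl (comp_le_comp le_rfl (comp_le_comp le_rfl
    (comp_le_comp (whiskerLeft_mono _ (whiskerRight_mono h _)) le_rfl)))

theorem isMap.id_le_comp_dagger {X Y : C} {f : X ⟶ Y} (hf : isMap C f) : 𝟙 X ≤ f ≫ dagger f :=
  CartesianBicategory.id_le_comp_dagger f hf.2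

theorem isMap.dagger_comp_le_id {X Y : C} {f : X ⟶ Y} (hf : isMap C f) : dagger f ≫ f ≤ 𝟙 Y :=
  CartesianBicategory.dagger_comp_le_id f hf.1

/-- A total arrow below a map is equal to it. -/
theorem isMap.eq_of_le {X Y : C} {h f : X ⟶ Y} (hf : isMap C f) (hh : ε[X] ≤ h ≫ ε[Y])
    (hle : h ≤ f) : h = f := by
  refine le_antisymm hle ?_
  -- Totality of `h` inserts `h ≫ dagger h`; enlarging `dagger h` to `dagger f` lets the counit of
  -- `f` absorb `f`.
  calc f = 𝟙 X ≫ f := (Category.id_comp f).symm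
    _ ≤ (h ≫ dagger h) ≫ f := comp_le_comp (CartesianBicategory.id_le_comp_dagger h hh) le_rfl
    _ = h ≫ dagger h ≫ f := Category.assoc _ _ _
    _ ≤ h ≫ dagger f ≫ f := comp_le_comp le_rfl (comp_le_comp (dagger_mono hle) le_rfl)
    _ ≤ h ≫ 𝟙 Y := comp_le_comp le_rfl hf.dagger_comp_le_id
    _ = h := Category.comp_id h

/-- Maps whose meet is total are equal. -/
theorem isMap.eq_of_discard_le {X Y : C} {f g : X ⟶ Y} (hf : isMap C f) (hg : isMap C g)
    (h : ε[X] ≤ (f ⊓ g) ≫ ε[Y]) : f = g :=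
  (hf.eq_of_le h inf_le_left).symm.trans (hg.eq_of_le h inf_le_right)

/-- Precomposition with a map is right adjoint to precomposition with its dagger. -/
theorem isMap.dagger_comp_le_iff {X Y Z : C} {f : X ⟶ Y} (hf : isMap C f) (r : X ⟶ Z)
    (s : Y ⟶ Z) : dagger f ≫ r ≤ s ↔ r ≤ f ≫ s := by
  constructor
  · intro h
    calc r = 𝟙 X ≫ r := (Category.id_comp r).symm
      _ ≤ (f ≫ dagger f) ≫ r := comp_le_comp hf.id_le_comp_dagger le_rfl
      _ = f ≫ dagger f ≫ r := Category.assoc _ _ _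
      _ ≤ f ≫ s := comp_le_comp le_rfl h
  · intro h
    calc dagger f ≫ r ≤ dagger f ≫ f ≫ s := comp_le_comp le_rfl h
      _ = (dagger f ≫ f) ≫ s := (Category.assoc _ _ _).symm
      _ ≤ 𝟙 Y ≫ s := comp_le_comp hf.dagger_comp_le_id le_rfl
      _ = s := Category.id_comp s

/-- The hypothesis is internal injectivity: the kernel predicate of `f` implies equality on `X`. -/
theorem comp_dagger_le_id {X Y : C} (f : X ⟶ Y)
    (h : (f ⊗ₘ f) ≫ μ[Y] ≫ ε[Y] ≤ μ[X] ≫ ε[X]) : f ≫ dagger f ≤ 𝟙 X := by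
  rw [comp_dagger, ← bend_cocopy_discard]
  exact bend_mono h

/-! ### From tabulations to full comprehensions -/

/-- A map along which the tabulated predicate becomes true factors through the tabulation. -/
theorem IsTabulation.exists_factor {X Y Z : C} {r : X ⟶ 𝟙_ C} {i : Z ⟶ X} (h : IsTabulation r i)
    {f : Y ⟶ X} (hf : isMap C f) (hr : ε[Y] ≤ f ≫ r) : ∃ g : Y ⟶ Z, isMap C g ∧ f = g ≫ i := by
  obtain ⟨hi, hid, ht⟩ := h
  -- The composite lies below the map `f` and is total because `dagger i ≫ ε = r` is true along `f`.
  have hgi : (f ≫ dagger i) ≫ i = f := by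
    refine hf.eq_of_le ?_ ?_
    · rw [Category.assoc, hi.discard, Category.assoc, ht]
      exact hr
    · calc (f ≫ dagger i) ≫ i = f ≫ dagger i ≫ i := Category.assoc _ _ _
        _ ≤ f ≫ 𝟙 X := comp_le_comp le_rfl hi.dagger_comp_le_id
        _ = f := Category.comp_id f
  -- The factor is a map because `i ≫ dagger f` is its right adjoint.
  refine ⟨f ≫ dagger i, isMap_of_adjoint _ (i ≫ dagger f) ?_ ?_, hgi.symm⟩
  · rw [← Category.assoc, hgi]
    exact hf.id_le_comp_dagger
  · calc (i ≫ dagger f) ≫ f ≫ dagger i = i ≫ (dagger f ≫ f) ≫ dagger i := by simp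
      _ ≤ i ≫ 𝟙 X ≫ dagger i :=
        comp_le_comp le_rfl (comp_le_comp hf.dagger_comp_le_id le_rfl)
      _ = 𝟙 Z := by rw [Category.id_comp, hid]

theorem IsTabulation.comp_eq_discard {X Z : C} {r : X ⟶ 𝟙_ C} {i : Z ⟶ X}
    (h : IsTabulation r i) : i ≫ r = ε[Z] := by
  obtain ⟨-, hid, ht⟩ := h
  rw [← ht, ← Category.assoc, hid, Category.id_comp]

theorem reindex_homDoctrine_eq_top {X Y : MapCat C} (f : X ⟶ Y) (r : Y.obj ⟶ 𝟙_ C) :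
    reindex (homDoctrine C).functor f r = ⊤ ↔ f.hom ≫ r = ε[X.obj] := by
  rw [← top_unit]
  exact Iff.rfl

/-- A tabulation of an arrow into the unit is a comprehension of it. -/
theorem IsTabulation.isComprehension {X Z : MapCat C} {r : X.obj ⟶ 𝟙_ C} {i : Z.obj ⟶ X.obj}
    (h : IsTabulation r i) : (homDoctrine C).IsComprehension (X := X) r (Z := Z) ⟨i, h.1⟩ := by
  refine ⟨(reindex_homDoctrine_eq_top _ _).2 h.comp_eq_discard, fun Y f hf => ?_⟩
  obtain ⟨g, hg, hgi⟩ := h.exists_factor f.2 ((reindex_homDoctrine_eq_top _ _).1 hf).ge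
  refine ⟨⟨g, hg⟩, WideSubcategory.hom_ext _ hgi, fun g' hg' => WideSubcategory.hom_ext _ ?_⟩
  have hg'i : f.hom = g'.hom ≫ i := congrArg (fun k => k.hom) hg'
  calc g'.hom = g'.hom ≫ i ≫ dagger i := by rw [h.2.1, Category.comp_id]
    _ = g ≫ i ≫ dagger i := by rw [← Category.assoc, ← hg'i, hgi, Category.assoc]
    _ = g := by rw [h.2.1, Category.comp_id]

theorem FunctionallyComplete.hasFullComprehensions (h : FunctionallyComplete C) :
    (homDoctrine C).HasFullComprehensions := by
  refine ⟨fun X r => ?_, fun X r s Z W c d hc hd ⟨g, hg⟩ => ?_⟩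
  · obtain ⟨Z, i, hi⟩ := h X.obj r
    exact ⟨⟨Z⟩, ⟨i, hi.1⟩, hi.isComprehension⟩
  · change X.obj ⟶ 𝟙_ C at r s
    obtain ⟨T, i, hi⟩ := h X.obj r
    -- The given comprehension `c` is arbitrary, so the tabulation `i` is factored through it, and
    -- hence through `d`; then `s` is true along `i`, whose image is `r`.
    obtain ⟨k, hk, -⟩ := hc.2 ⟨T⟩ ⟨i, hi.1⟩
      ((reindex_homDoctrine_eq_top _ _).2 hi.comp_eq_discard)
    have hik : i = k.hom ≫ g.hom ≫ d.hom := by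
      rw [hg] at hk
      exact congrArg (fun m => m.hom) hk
    have hds : d.hom ≫ s = ε[W.obj] := (reindex_homDoctrine_eq_top _ _).1 hd.1
    change r ≤ s
    rw [← hi.2.2, hi.1.dagger_comp_le_iff, hik, Category.assoc, Category.assoc, hds, g.2.discard,
      k.2.discard]

/-! ### From full comprehensions to tabulations -/

/-- If the doctrine of `C` has full comprehensions, then a predicate implies every predicate that
holds along a comprehension of it. -/
theorem le_of_isComprehension (h : (homDoctrine C).HasFullComprehensions) {X Z : MapCat C}
    {r s : X.obj ⟶ 𝟙_ C} {c : Z ⟶ X} (hc : (homDoctrine C).IsComprehension (X := X) r c)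
    (hs : c.hom ≫ s = ε[Z.obj]) : r ≤ s := by
  obtain ⟨W, d, hd⟩ := h.1 X s
  exact h.2 X r s Z W c d hc hd (hd.2 Z c ((reindex_homDoctrine_eq_top _ _).2 hs)).exists

/-- Uniqueness of factorizations makes `i` monic among maps; testing along a comprehension `k` of
the kernel predicate of `i` upgrades this to internal injectivity. -/
theorem comprehension_comp_dagger (h : (homDoctrine C).HasFullComprehensions) {X Z : MapCat C}
    {r : X.obj ⟶ 𝟙_ C} {i : Z ⟶ X} (hi : (homDoctrine C).IsComprehension (X := X) r i) :
    i.hom ≫ dagger i.hom = 𝟙 Z.obj := by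
  refine le_antisymm (comp_dagger_le_id _ ?_) i.2.id_le_comp_dagger
  obtain ⟨K, k, hk⟩ := h.1 (Z ⊗ Z) ((i.hom ⊗ₘ i.hom) ≫ μ[X.obj] ≫ ε[X.obj])
  have hkt := (reindex_homDoctrine_eq_top _ _).1 hk.1
  have hk_eq : k = lift (k ≫ fst Z Z) (k ≫ snd Z Z) := by ext1 <;> simp
  have hk_hom : k.hom = Δ[K.obj] ≫ ((k ≫ fst Z Z).hom ⊗ₘ (k ≫ snd Z Z).hom) := by
    rw [← lift_hom, ← hk_eq]
  have hir : i.hom ≫ r = ε[Z.obj] := (reindex_homDoctrine_eq_top _ _).1 hi.1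
  -- The kernel predicate being true along `k` says exactly that the meet of these two maps is
  -- total.
  have hpair : (k ≫ fst Z Z) ≫ i = (k ≫ snd Z Z) ≫ i := by
    refine WideSubcategory.hom_ext _
      (((k ≫ fst Z Z) ≫ i).2.eq_of_discard_le ((k ≫ snd Z Z) ≫ i).2 ?_)
    rw [inf_def]
    rw [hk_hom] at hkt
    rw [← hkt, WideSubcategory.comp_def _ (k ≫ fst Z Z) i,
      WideSubcategory.comp_def _ (k ≫ snd Z Z) i,
      ← tensorHom_comp_tensorHom]
    simp only [Category.assoc, le_refl]
  have hproj : k ≫ fst Z Z = k ≫ snd Z Z := by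
    refine (hi.2 K ((k ≫ fst Z Z) ≫ i) ((reindex_homDoctrine_eq_top _ _).2 ?_)).unique rfl hpair
    rw [WideSubcategory.comp_def, Category.assoc, hir, (k ≫ fst Z Z).2.discard]
  refine le_of_isComprehension h hk ?_
  -- With equal projections `k` factors through `Δ`, along which the equality predicate `μ ≫ ε` is
  -- true by `special`.
  rw [hk_hom, ← hproj, ← (k ≫ fst Z Z).2.copy, Category.assoc, ← Category.assoc Δ[_] μ[_],
    special, Category.id_comp, (k ≫ fst Z Z).2.discard]

theorem comprehension_dagger_comp_discard (h : (homDoctrine C).HasFullComprehensions)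
    {X Z : MapCat C} {r : X.obj ⟶ 𝟙_ C} {i : Z ⟶ X}
    (hi : (homDoctrine C).IsComprehension (X := X) r i) : dagger i.hom ≫ ε[Z.obj] = r := by
  refine le_antisymm ?_ (le_of_isComprehension h hi ?_)
  · rw [i.2.dagger_comp_le_iff]
    exact ((reindex_homDoctrine_eq_top _ _).1 hi.1).ge
  · rw [← Category.assoc, comprehension_comp_dagger h hi, Category.id_comp]

theorem functionallyComplete_of_hasFullComprehensions
    (h : (homDoctrine C).HasFullComprehensions) : FunctionallyComplete C := fun X r => by
  obtain ⟨Z, i, hi⟩ := h.1 ⟨X⟩ r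
  exact ⟨Z.obj, i.hom, i.2, comprehension_comp_dagger h hi,
    comprehension_dagger_comp_discard h hi⟩

end CartesianBicategory

theorem mainTheorem5 (C : Type u) [Category.{v} C] [MonoidalCategory C] [CartesianBicategory C] :
    CartesianBicategory.FunctionallyComplete C ↔
      (CartesianBicategory.homDoctrine C).HasFullComprehensions :=
  ⟨fun h => h.hasFullComprehensions,
    CartesianBicategory.functionallyComplete_of_hasFullComprehensions⟩
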